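/- Let $V$ be a real vector space, let $R:V\to\mathbb R\cup\{+\infty\}$ and $f:\mathbb R^m\to\mathbb R\cup\{+\infty\}$ be convex functions, and let $\Phi:V\to\mathbb R^m$ be linear and surjective. Let $S$ be the set of minimizers of $u\mapsto R(u)+f(\Phi u)$ over $V$, and let $p\in S$ with $R(p)+f(\Phi p)<+\infty$. Write $C=\{u\in V: R(u)\le R(p)\}$ and $D=\{w\in\mathbb R^m: f(w)\le f(\Phi p)\}$. Assume that $C$ is linearly closed (its intersection with every line is closed in that line) and contains no line. A face of a convex set $K$ is a convex subset $F\subseteq K$ such that every open interval $I\subseteq K$ which meets $F$ is contained in $F$; its dimension is that of its affine hull. The elementary face of $x\in K$ is the intersection of all faces of $K$ containing $x$. An extreme ray of $K$ is a half-line which is a face of $K$. Assume that $p$ belongs to a face of $S$ of finite dimension $j$, let $\ell$ be the dimension of the elementary face of $\Phi p$ in $D$, and set $$k=\begin{cases} m-\ell+j-1 & \text{if } R(p)>\inf R \text{ or } f(\Phi p)>\inf f,\\ m-\ell+j & \text{otherwise.}\end{cases}$$ Then $p$ is a convex combination of at most $k+1$ extreme points of $C$, or $p$ is a convex combination of at most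 $k$ points of $C$, each of which is an extreme point of $C$ or a point in an extreme ray of $C$. Moreover, the same conclusion holds with $k=m-\ell+j-2$ if $p$ satisfies the double obliqueness condition: with $\mu=R(p)+f(\Phi p)$, let $\hat E$ and $E$ be the affine hulls of the elementary face of $(p,R(p))$ in the epigraph of $R$ and of the elementary face of $p$ in $C$, and let $\hat H$ and $H$ be the affine hulls of the elementary face of $(\Phi p,\mu-f(\Phi p))$ in the hypograph of $\mu-f$ and of the elementary face of $\Phi p$ in $D$; the condition is that $E\times\{R(p)\}$ has codimension $1$ in $\hat E$ and $H\times\{\mu-f(\Phi p)\}$ has codimension $1$ in $\hat H$. -/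

import Mathlib

/-- A convex function `V → ℝ ∪ {+∞}`: an extended-real-valued function that never takes the value
`-∞` and satisfies the convexity inequality. -/
structure IsConvexExt {V : Type*} [AddCommGroup V] [Module ℝ V] (R : V → EReal) : Prop where
  ne_bot : ∀ x, R x ≠ ⊥
  convex : ∀ (x y : V) (a b : ℝ), 0 < a → 0 < b → a + b = 1 →
    R (a • x + b • y) ≤ (a : EReal) * R x + (b : EReal) * R y

/-- The level set `{R ≤ R p}`. -/
def levelSet {V : Type*} (R : V → EReal) (p : V) : Set V :=
  {u | R u ≤ R p}

/-- The set of solutions of `min_u R u + f (Φ u)`. -/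
def solutionSet {V W : Type*} (R : V → EReal) (f : W → EReal) (Φ : V → W) : Set V :=
  {u | ∀ v, R u + f (Φ u) ≤ R v + f (Φ v)}

/-- `C` meets every line in a closed subset of that line. -/
def IsLinearlyClosed {V : Type*} [AddCommGroup V] [Module ℝ V] (C : Set V) : Prop :=
  ∀ a v : V, v ≠ 0 → IsClosed {t : ℝ | a + t • v ∈ C}

/-- `C` contains no line `a + ℝ v`, `v ≠ 0`. -/
def ContainsNoLine {V : Type*} [AddCommGroup V] [Module ℝ V] (C : Set V) : Prop :=
  ∀ a v : V, v ≠ 0 → ¬ ∀ t : ℝ, a + t • v ∈ C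

/-- `F` is a face of `C`: a convex subset of `C` that contains every open interval of `C` which it
meets. Only the open interval has to lie in `C`, and only the open interval has to lie in `F`, so
that for instance `(0,1)` is a face of `[0,1]`; `IsExtreme` is a different notion.
(For `x = y` Mathlib's `openSegment x y` is `{x}` and the condition is void.) -/
structure IsConvexFace {V : Type*} [AddCommGroup V] [Module ℝ V] (C F : Set V) : Prop where
  subset : F ⊆ C
  convex : Convex ℝ F
  openSegment_subset : ∀ x y : V, openSegment ℝ x y ⊆ C →
    (openSegment ℝ x y ∩ F).Nonempty → openSegment ℝ x y ⊆ F

/-- The elementary (minimal) face of `x` in `C`: the intersection of all faces containing `x`. -/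
def elementaryFace {V : Type*} [AddCommGroup V] [Module ℝ V] (C : Set V) (x : V) : Set V :=
  ⋂₀ {F | IsConvexFace C F ∧ x ∈ F}

/-- The dimension of (the affine hull of) a set. -/
noncomputable def affDim {V : Type*} [AddCommGroup V] [Module ℝ V] (F : Set V) : Cardinal :=
  Module.rank ℝ (vectorSpan ℝ F)

/-- The closed half-line `{a + t v : t ≥ 0}`. -/
def halfLine {V : Type*} [AddCommGroup V] [Module ℝ V] (a v : V) : Set V :=
  {x | ∃ t : ℝ, 0 ≤ t ∧ x = a + t • v}

/-- An extreme ray of `C`: a half-line which is a face of `C`. -/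
def IsExtremeRay {V : Type*} [AddCommGroup V] [Module ℝ V] (C ρ : Set V) : Prop :=
  (∃ a v : V, v ≠ 0 ∧ ρ = halfLine a v) ∧ IsConvexFace C ρ

/-- The points of `C` that lie in an extreme ray of `C`. -/
def extremeRayPoints {V : Type*} [AddCommGroup V] [Module ℝ V] (C : Set V) : Set V :=
  {x | ∃ ρ, IsExtremeRay C ρ ∧ x ∈ ρ}

/-- `p` is a convex combination of at most `N` points of `A`. -/
def IsConvexCombOfAtMost {V : Type*} [AddCommGroup V] [Module ℝ V]
    (N : ℤ) (A : Set V) (p : V) : Prop :=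
  ∃ s : Finset V, (s.card : ℤ) ≤ N ∧ (s : Set V) ⊆ A ∧ p ∈ convexHull ℝ (s : Set V)

/-- The epigraph of `R`, in `V × ℝ`. -/
def epigraph {V : Type*} (R : V → EReal) : Set (V × ℝ) :=
  {x | R x.1 ≤ (x.2 : EReal)}

/-- The hypograph of `g`, in `V × ℝ`. -/
def hypograph {V : Type*} (g : V → EReal) : Set (V × ℝ) :=
  {x | (x.2 : EReal) ≤ g x.1}

/-- The codimension of `B` in `A` (used for `B ≤ A`). -/
noncomputable def codimIn {V : Type*} [AddCommGroup V] [Module ℝ V]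
    (A B : Submodule ℝ V) : Cardinal :=
  Module.rank ℝ (A ⧸ B.submoduleOf A)

/-- The elementary face of `(x, r)` in `A ⊆ V × ℝ` is oblique with respect to the elementary face
of `x` in the horizontal section `C`: the affine hull of the latter, placed at height `r`, has
codimension one in the affine hull of the former. -/
def IsObliqueFace {V : Type*} [AddCommGroup V] [Module ℝ V]
    (A : Set (V × ℝ)) (C : Set V) (x : V) (r : ℝ) : Prop :=
  codimIn (vectorSpan ℝ (elementaryFace A (x, r)))
    ((vectorSpan ℝ (elementaryFace C x)).prod ⊥) = 1

/-- The double obliqueness condition at `p`: with `μ = R p + f (Φ p)`, the elementary faces of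
`(p, R p)` in the epigraph of `R` and of `(Φ p, μ - f (Φ p))` in the hypograph of `μ - f` are both
oblique. -/
def DoubleOblique {V W : Type*} [AddCommGroup V] [Module ℝ V] [AddCommGroup W] [Module ℝ W]
    (R : V → EReal) (f : W → EReal) (Φ : V →ₗ[ℝ] W) (p : V) : Prop :=
  IsObliqueFace (epigraph R) (levelSet R p) p (R p).toReal ∧
  IsObliqueFace (hypograph fun w => R p + f (Φ p) - f w) (levelSet f (Φ p)) (Φ p)
    (R p + f (Φ p) - f (Φ p)).toReal

/-- `p` is a convex combination of at most `k + 1` extreme points of `C`, or of at most `k` points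
of `C`, each an extreme point or a point in an extreme ray. -/
def HasAtomicRepr {V : Type*} [AddCommGroup V] [Module ℝ V] (C : Set V) (p : V) (k : ℤ) : Prop :=
  IsConvexCombOfAtMost (k + 1) (C.extremePoints ℝ) p ∨
  IsConvexCombOfAtMost k (C.extremePoints ℝ ∪ extremeRayPoints C) p

/-! The argument is a dimension count followed by a theorem of Dubins and Klee. The affine hull of
the elementary face of `x` in a convex set is directed by the space of vectors along which the set
extends both ways from `x` (`vectorSpan_elementaryFace`), so faces can be handled by feasible
directions alone.

Let `M` and `N` be these spaces for `C` at `p` and for `D` at `Φ p`. Along a direction of `M` sent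
by `Φ` into `N`, neither `R` nor `f ∘ Φ` increases, so the solution set extends both ways along it:
`M ⊓ Φ⁻¹ N` lies in the span of the given face of `S`. The kernel of `M → ℝ^m / N` thus has
dimension at most `j`, whence `dim M ≤ m - ℓ + j`. If `p` or `Φ p` is not a global minimizer of its
term, a descent direction of that term lies outside `Φ M + N`; the map is not onto, and one
dimension is gained.

The inclusion survives when `M` and `N` are enlarged to the directions along which `R` and `f` are
affine, because optimality forces the two slopes to cancel. Double obliqueness makes both
enlargements strict, which gains two dimensions.

It remains to represent a point whose elementary face has dimension `d`
(`hasAtomicRepr_finrank_dirSpace`). It is a convex combination of extreme points and points of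
extreme rays, by induction on `d`; a Carathéodory exchange then brings the number of points down. -/

/-! ### Feasible directions and elementary faces -/

section FeasibleDirections

variable {V : Type*} [AddCommGroup V] [Module ℝ V] {K : Set V} {x : V}

/-- `v` is a feasible direction of `K` at `x`. -/
def FeasDir (K : Set V) (x v : V) : Prop := ∃ ε : ℝ, 0 < ε ∧ x + ε • v ∈ K

lemma FeasDir.smul {v : V} (h : FeasDir K x v) {c : ℝ} (hc : 0 < c) : FeasDir K x (c • v) := by
  obtain ⟨ε, hε, h⟩ := h
  refine ⟨ε / c, by positivity, ?_⟩
  rwa [smul_smul, div_mul_cancel₀ _ hc.ne']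

lemma feasDir_zero (hx : x ∈ K) : FeasDir K x 0 := ⟨1, one_pos, by simpa⟩

lemma feasDir_sub {y : V} (hy : y ∈ K) : FeasDir K x (y - x) := ⟨1, one_pos, by simpa⟩

lemma Convex.add_smul_mem_of_le (hK : Convex ℝ K) (hx : x ∈ K) {v : V} {s t : ℝ}
    (ht : x + t • v ∈ K) (hs : 0 ≤ s) (hst : s ≤ t) : x + s • v ∈ K := by
  rcases hs.eq_or_lt with rfl | hs
  · simpa
  · have := hK.add_smul_mem hx ht (t := s / t)
      ⟨by have := hs.trans_le hst; positivity, (div_le_one (hs.trans_le hst)).2 hst⟩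
    rwa [smul_smul, div_mul_cancel₀ _ (hs.trans_le hst).ne'] at this

lemma FeasDir.add (hK : Convex ℝ K) (hx : x ∈ K) {v w : V} (hv : FeasDir K x v)
    (hw : FeasDir K x w) : FeasDir K x (v + w) := by
  obtain ⟨ε, hε, hv⟩ := hv
  obtain ⟨δ, hδ, hw⟩ := hw
  have hm : 0 < min ε δ := lt_min hε hδ
  refine ⟨min ε δ / 2, by positivity, ?_⟩
  have := hK (hK.add_smul_mem_of_le hx hv hm.le (min_le_left _ _))
    (hK.add_smul_mem_of_le hx hw hm.le (min_le_right _ _))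
    (a := 1 / 2) (b := 1 / 2) (by norm_num) (by norm_num) (by norm_num)
  convert this using 1
  module

/-- The space of directions in which `K` extends both ways from `x`. -/
def dirSpace (hK : Convex ℝ K) (hx : x ∈ K) : Submodule ℝ V where
  carrier := {v | FeasDir K x v ∧ FeasDir K x (-v)}
  add_mem' := by
    rintro v w ⟨hv, hv'⟩ ⟨hw, hw'⟩
    refine ⟨hv.add hK hx hw, ?_⟩
    rw [neg_add]
    exact hv'.add hK hx hw'
  zero_mem' := by simpa using feasDir_zero hx
  smul_mem' := by
    rintro c v ⟨hv, hv'⟩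
    rcases lt_trichotomy c 0 with hc | rfl | hc
    · have h := hv.smul (neg_pos.2 hc)
      have h' := hv'.smul (neg_pos.2 hc)
      simp only [smul_neg, neg_smul, neg_neg] at h h'
      exact ⟨h', h⟩
    · simpa using feasDir_zero hx
    · refine ⟨hv.smul hc, ?_⟩
      rw [← smul_neg]
      exact hv'.smul hc

lemma mem_dirSpace {hK : Convex ℝ K} {hx : x ∈ K} {v : V} :
    v ∈ dirSpace hK hx ↔ FeasDir K x v ∧ FeasDir K x (-v) := Iff.rfl

/-- If `K` continues past `x` on the ray coming from `z`, then `x` lies between `z` and a point of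
`K`; the homothety centred at that point carries a small move at `z` to a move at `x`. -/
lemma FeasDir.trans (hK : Convex ℝ K) {z v : V} (hxz : FeasDir K x (x - z))
    (hv : FeasDir K z v) : FeasDir K x v := by
  obtain ⟨δ, hδ, hδK⟩ := hxz
  obtain ⟨ε, hε, hεK⟩ := hv
  refine ⟨δ / (1 + δ) * ε, by positivity, ?_⟩
  have := hK hεK hδK (a := δ / (1 + δ)) (b := 1 / (1 + δ)) (by positivity) (by positivity)
    (by field_simp; ring)
  convert this using 1
  match_scalars <;> field_simp
  ring

lemma dirSpace_le_of_sub_mem (hK : Convex ℝ K) (hx : x ∈ K) {z : V} (hz : z ∈ K)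
    (h : z - x ∈ dirSpace hK hx) : dirSpace hK hz ≤ dirSpace hK hx := by
  have h' : FeasDir K x (x - z) := by simpa using (mem_dirSpace.1 h).2
  exact fun v hv => ⟨h'.trans hK hv.1, h'.trans hK hv.2⟩

lemma sub_mem_dirSpace_of_mem_openSegment (hK : Convex ℝ K) (hx : x ∈ K) {a b : V} (ha : a ∈ K)
    (hb : b ∈ K) (h : x ∈ openSegment ℝ a b) : a - x ∈ dirSpace hK hx := by
  obtain ⟨s, t, hs, ht, hst, rfl⟩ := h
  refine ⟨feasDir_sub ha, ?_⟩
  have h := (feasDir_sub (x := s • a + t • b) hb).smul (c := t / s) (by positivity)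
  convert h using 1
  obtain rfl : t = 1 - s := by linarith
  match_scalars <;> field_simp
  ring

lemma sub_mem_dirSpace_of_openSegment (hK : Convex ℝ K) (hx : x ∈ K) {a b z : V} (ha : a ∈ K)
    (hb : b ∈ K) (hz : z ∈ openSegment ℝ a b) (hzx : z - x ∈ dirSpace hK hx) :
    a - x ∈ dirSpace hK hx := by
  have hzK : z ∈ K := hK.openSegment_subset ha hb hz
  have := dirSpace_le_of_sub_mem hK hx hzK hzx
    (sub_mem_dirSpace_of_mem_openSegment hK hzK ha hb hz)
  simpa using add_mem this hzx

/-- The face axiom concerns open intervals whose endpoints may lie outside `K`. Prolonging from `w`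
slightly past `z` replaces them by points of `K`. -/
lemma exists_openSegment_of_mem_openSegment {a b z w : V} (hz : z ∈ openSegment ℝ a b)
    (hw : w ∈ openSegment ℝ a b) (hne : w ≠ z) :
    ∃ y ∈ openSegment ℝ a b, z ∈ openSegment ℝ w y := by
  rw [openSegment_eq_image_lineMap] at hz hw
  obtain ⟨s, hs, rfl⟩ := hz
  obtain ⟨t, ht, rfl⟩ := hw
  have key : ∃ r ∈ Set.Ioo (0 : ℝ) 1, s ∈ openSegment ℝ t r := by
    rcases lt_trichotomy t s with h | rfl | h
    · obtain ⟨r, hr, hr'⟩ := exists_between hs.2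
      exact ⟨r, ⟨hs.1.trans hr, hr'⟩, by rw [openSegment_eq_Ioo (h.trans hr)]; exact ⟨h, hr⟩⟩
    · exact absurd rfl hne
    · obtain ⟨r, hr, hr'⟩ := exists_between hs.1
      refine ⟨r, ⟨hr, hr'.trans hs.2⟩, ?_⟩
      rw [openSegment_symm, openSegment_eq_Ioo (hr'.trans h)]
      exact ⟨hr', h⟩
  obtain ⟨r, hr, hsr⟩ := key
  refine ⟨AffineMap.lineMap a b r, ?_, ?_⟩
  · rw [openSegment_eq_image_lineMap]
    exact ⟨r, hr, rfl⟩
  · rw [← image_openSegment]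
    exact ⟨s, hsr, rfl⟩

/-- The trace of `K` on the affine space through `x` directed by `dirSpace` is a face. -/
lemma isConvexFace_setOf_sub_mem_dirSpace (hK : Convex ℝ K) (hx : x ∈ K) :
    IsConvexFace K {z | z ∈ K ∧ z - x ∈ dirSpace hK hx} where
  subset := fun z hz => hz.1
  convex := by
    rintro y ⟨hy, hy'⟩ z ⟨hz, hz'⟩ a b ha hb hab
    refine ⟨hK hy hz ha hb hab, ?_⟩
    have : a • y + b • z - x = a • (y - x) + b • (z - x) := by
      obtain rfl : b = 1 - a := by linarith
      module
    rw [this]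
    exact add_mem (Submodule.smul_mem _ _ hy') (Submodule.smul_mem _ _ hz')
  openSegment_subset := by
    rintro a b hab ⟨z, hz, -, hzx⟩ w hw
    refine ⟨hab hw, ?_⟩
    by_cases hne : w = z
    · rwa [hne]
    obtain ⟨y, hy, hzy⟩ := exists_openSegment_of_mem_openSegment hz hw hne
    exact sub_mem_dirSpace_of_openSegment hK hx (hab hw) (hab hy) hzy hzx

lemma vectorSpan_elementaryFace (hK : Convex ℝ K) (hx : x ∈ K) :
    vectorSpan ℝ (elementaryFace K x) = dirSpace hK hx := by
  apply le_antisymm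
  · rw [vectorSpan_def, Submodule.span_le]
    rintro _ ⟨a, ha, b, hb, rfl⟩
    have hmem := isConvexFace_setOf_sub_mem_dirSpace hK hx
    have ha' := (ha _ ⟨hmem, hx, by simp⟩).2
    have hb' := (hb _ ⟨hmem, hx, by simp⟩).2
    simpa using sub_mem ha' hb'
  · rintro v ⟨⟨ε, hε, h⟩, ⟨δ, hδ, h'⟩⟩
    have hm : 0 < min ε δ := lt_min hε hδ
    set η := min ε δ
    have h₁ := hK.add_smul_mem_of_le hx h hm.le (min_le_left _ _)
    have h₂ := hK.add_smul_mem_of_le hx h' hm.le (min_le_right _ _)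
    -- Half the step: the endpoint `x + η • v` need not belong to a face containing the open
    -- segment.
    have hmem : x + (η / 2) • v ∈ elementaryFace K x := by
      rintro F ⟨hF, hxF⟩
      exact hF.openSegment_subset _ _ (hK.openSegment_subset h₁ h₂)
        ⟨x, ⟨1 / 2, 1 / 2, by norm_num, by norm_num, by norm_num, by module⟩, hxF⟩
        ⟨3 / 4, 1 / 4, by norm_num, by norm_num, by norm_num, by module⟩
    have hxx : x ∈ elementaryFace K x := fun F hF => hF.2
    have := vsub_mem_vectorSpan ℝ hmem hxx
    rw [vsub_eq_sub, add_sub_cancel_left] at this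
    exact (Submodule.smul_mem_iff _ (by positivity)).1 this

lemma IsConvexFace.dirSpace_le {F : Set V} (hF : IsConvexFace K F) (hK : Convex ℝ K) (hx : x ∈ K)
    (hxF : x ∈ F) : dirSpace hK hx ≤ vectorSpan ℝ F := by
  rw [← vectorSpan_elementaryFace hK hx]
  exact vectorSpan_mono ℝ (Set.sInter_subset_of_mem ⟨hF, hxF⟩)

end FeasibleDirections

/-! ### Convex hull of extreme points and extreme rays -/

section Hull

variable {V : Type*} [AddCommGroup V] [Module ℝ V] {C : Set V} {p : V}

lemma IsLinearlyClosed.isClosed_preimage (hC : IsLinearlyClosed C) (a v : V) :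
    IsClosed {t : ℝ | a + t • v ∈ C} := by
  by_cases hv : v = 0
  · by_cases ha : a ∈ C <;> simp [hv, ha]
  · exact hC a v hv

lemma exists_last_mem (hC : IsLinearlyClosed C) (hK : Convex ℝ C) (hp : p ∈ C) {v : V}
    (hv : ¬ ∀ t : ℝ, 0 ≤ t → p + t • v ∈ C) :
    ∃ τ : ℝ, 0 ≤ τ ∧ p + τ • v ∈ C ∧ ∀ t, τ < t → p + t • v ∉ C := by
  push Not at hv
  obtain ⟨b, hb, hbC⟩ := hv
  set T : Set ℝ := {t | 0 ≤ t ∧ p + t • v ∈ C}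
  have hcl : IsClosed T := isClosed_Ici.inter (hC.isClosed_preimage p v)
  have h0 : (0 : ℝ) ∈ T := ⟨le_rfl, by simpa⟩
  have hbdd : BddAbove T := ⟨b, fun t ht => by
    by_contra! h
    exact hbC (hK.add_smul_mem_of_le hp ht.2 hb h.le)⟩
  have hmem := hcl.csSup_mem ⟨0, h0⟩ hbdd
  exact ⟨sSup T, hmem.1, hmem.2, fun t ht h =>
    ht.not_ge (le_csSup hbdd ⟨hmem.1.trans ht.le, h⟩)⟩

lemma not_feasDir_of_last {v : V} {τ : ℝ} (h : ∀ t, τ < t → p + t • v ∉ C) :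
    ¬ FeasDir C (p + τ • v) v := by
  rintro ⟨ε, hε, hmem⟩
  refine h (τ + ε) (by linarith) ?_
  rwa [add_smul, ← add_assoc]

/-- At the exit point the space can only shrink, and it loses `v`, which is no longer feasible
there. -/
lemma finrank_dirSpace_lt (hK : Convex ℝ C) (hp : p ∈ C) [FiniteDimensional ℝ (dirSpace hK hp)]
    {v : V} (hv : v ∈ dirSpace hK hp) {τ : ℝ} (hτ : p + τ • v ∈ C)
    (h : ∀ t, τ < t → p + t • v ∉ C) :
    FiniteDimensional ℝ (dirSpace hK hτ) ∧
      Module.finrank ℝ (dirSpace hK hτ) < Module.finrank ℝ (dirSpace hK hp) := by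
  have hle : dirSpace hK hτ ≤ dirSpace hK hp := dirSpace_le_of_sub_mem hK hp hτ (by
    simpa using Submodule.smul_mem _ τ hv)
  refine ⟨Submodule.finiteDimensional_of_le hle, Submodule.finrank_lt_finrank_of_lt
    (lt_of_le_of_ne hle fun heq => not_feasDir_of_last h ?_)⟩
  rw [← heq] at hv
  exact hv.1

lemma mem_extremePoints_of_dirSpace_eq_bot (hK : Convex ℝ C) (hp : p ∈ C)
    (h : dirSpace hK hp = ⊥) : p ∈ C.extremePoints ℝ := by
  refine ⟨hp, fun a ha b hb hab => ?_⟩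
  have := sub_mem_dirSpace_of_mem_openSegment hK hp ha hb hab
  rw [h, Submodule.mem_bot] at this
  exact sub_eq_zero.1 this

/-- If every line of `dirSpace` contains a recession direction, then `dirSpace` is a line. -/
lemma exists_smul_of_forall_recession (hC : IsLinearlyClosed C) (hN : ContainsNoLine C)
    {L : Submodule ℝ V}
    (hrec : ∀ u ∈ L, (∀ t : ℝ, 0 ≤ t → p + t • u ∈ C) ∨ ∀ t : ℝ, 0 ≤ t → p + t • (-u) ∈ C)
    {u w : V} (hu : u ∈ L) (hw : w ∈ L) (hur : ∀ t : ℝ, 0 ≤ t → p + t • u ∈ C)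
    (hwr : ∀ t : ℝ, 0 ≤ t → p + t • w ∈ C) (hw0 : w ≠ 0) : ∃ s : ℝ, u = s • w := by
  by_contra! hne
  have noline : ∀ v : V, v ≠ 0 → (∀ t : ℝ, 0 ≤ t → p + t • v ∈ C) →
      ¬ ∀ t : ℝ, 0 ≤ t → p + t • (-v) ∈ C := fun v hv h h' => hN p v hv fun t => by
    rcases le_total 0 t with ht | ht
    · exact h t ht
    · simpa using h' (-t) (by linarith)
  set A : Set ℝ := {s | ∀ t : ℝ, 0 ≤ t → p + t • (u - s • w) ∈ C}
  set B : Set ℝ := {s | ∀ t : ℝ, 0 ≤ t → p + t • (-(u - s • w)) ∈ C}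
  have hA : IsClosed A := by
    simp only [A, Set.ofPred_forall]
    refine isClosed_iInter fun t => isClosed_iInter fun _ => ?_
    convert hC.isClosed_preimage (p + t • u) (-(t • w)) using 4
    module
  have hB : IsClosed B := by
    simp only [B, Set.ofPred_forall]
    refine isClosed_iInter fun t => isClosed_iInter fun _ => ?_
    convert hC.isClosed_preimage (p + t • (-u)) (t • w) using 4
    module
  -- Both sets are closed, and the absence of lines makes them complementary; connectedness of `ℝ`
  -- then gives `A = ℝ`, since `0 ∈ A`.
  have hAB : Aᶜ = B := by
    ext s
    have hmem : u - s • w ∈ L := sub_mem hu (L.smul_mem _ hw)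
    exact ⟨fun h => (hrec _ hmem).resolve_left h, fun h h' =>
      noline _ (sub_ne_zero.2 (hne s)) h' h⟩
  have hclopen : IsClopen A := ⟨hA, by rw [← isClosed_compl_iff, hAB]; exact hB⟩
  have huniv : A = Set.univ := hclopen.eq_univ ⟨0, by simpa [A] using hur⟩
  -- For `r > 0` the point `p - t • w + r • u` equals `p + r • (u - (t / r) • w)`, which is in `C`.
  -- Letting `r → 0` along this line makes `-w` a recession direction as well.
  refine noline w hw0 hwr fun t ht => ?_
  have hcl := hC.isClosed_preimage (p + t • (-w)) u
  have hsub : Set.Ioi (0 : ℝ) ⊆ {r : ℝ | p + t • (-w) + r • u ∈ C} := fun r hr => by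
    have hr : 0 < r := hr
    have h : t / r ∈ A := huniv ▸ Set.mem_univ _
    have := h r hr.le
    simp only [Set.mem_ofPred_eq]
    convert this using 1
    match_scalars <;> field_simp
  have h0 := hcl.closure_subset_iff.2 hsub
  rw [closure_Ioi] at h0
  simpa using h0 (Set.mem_Ici.2 le_rfl)

/-- Induction on the dimension of the elementary face. If some line of the face through `p` leaves
`C` on both sides, `p` lies between two exit points with smaller faces. Otherwise the face
directions form a line, and the closed trace of `C` on it is an extreme ray. -/
lemma mem_convexHull_extremePoints_union_extremeRayPoints (hC : IsLinearlyClosed C)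
    (hN : ContainsNoLine C) (hK : Convex ℝ C) (hp : p ∈ C)
    (hfin : FiniteDimensional ℝ (dirSpace hK hp)) :
    p ∈ convexHull ℝ (C.extremePoints ℝ ∪ extremeRayPoints C) := by
  induction hn : Module.finrank ℝ (dirSpace hK hp) using Nat.strong_induction_on generalizing p with
  | _ n ih =>
  subst hn
  by_cases hbot : dirSpace hK hp = ⊥
  · exact subset_convexHull ℝ _ (Or.inl (mem_extremePoints_of_dirSpace_eq_bot hK hp hbot))
  have step : ∀ {v : V}, v ∈ dirSpace hK hp → (¬ ∀ t : ℝ, 0 ≤ t → p + t • v ∈ C) →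
      ∃ τ : ℝ, 0 ≤ τ ∧ p + τ • v ∈ convexHull ℝ (C.extremePoints ℝ ∪ extremeRayPoints C) := by
    intro v hv hnr
    obtain ⟨τ, hτ, hmem, hlast⟩ := exists_last_mem hC hK hp hnr
    obtain ⟨hfd, hlt⟩ := finrank_dirSpace_lt hK hp hv hmem hlast
    exact ⟨τ, hτ, ih _ hlt hmem hfd rfl⟩
  by_cases hrec : ∀ u ∈ dirSpace hK hp,
      (∀ t : ℝ, 0 ≤ t → p + t • u ∈ C) ∨ ∀ t : ℝ, 0 ≤ t → p + t • (-u) ∈ C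
  · obtain ⟨u, hu, hu0, hur⟩ : ∃ u ∈ dirSpace hK hp, u ≠ 0 ∧ ∀ t : ℝ, 0 ≤ t → p + t • u ∈ C := by
      obtain ⟨u, hu, hu0⟩ := Submodule.exists_mem_ne_zero_of_ne_bot hbot
      rcases hrec u hu with h | h
      · exact ⟨u, hu, hu0, h⟩
      · exact ⟨-u, neg_mem hu, neg_ne_zero.2 hu0, h⟩
    have hspan : ∀ w ∈ dirSpace hK hp, ∃ s : ℝ, w = s • u := by
      intro w hw
      rcases hrec w hw with h | h
      · exact exists_smul_of_forall_recession hC hN hrec hw hu h hur hu0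
      · obtain ⟨s, hs⟩ := exists_smul_of_forall_recession hC hN hrec (neg_mem hw) hu h hur hu0
        exact ⟨-s, by rw [neg_smul, ← hs, neg_neg]⟩
    have hnr : ¬ ∀ t : ℝ, 0 ≤ t → p + t • (-u) ∈ C := fun h => hN p u hu0 fun t => by
      rcases le_total 0 t with ht | ht
      · exact hur t ht
      · simpa using h (-t) (by linarith)
    obtain ⟨τ, hτ, hmem, hlast⟩ := exists_last_mem hC hK hp hnr
    refine subset_convexHull ℝ _ (Or.inr ⟨halfLine (p + τ • (-u)) u, ⟨⟨_, u, hu0, rfl⟩, ?_⟩,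
      τ, hτ, by module⟩)
    have hface := isConvexFace_setOf_sub_mem_dirSpace hK hp
    have heq : {z | z ∈ C ∧ z - p ∈ dirSpace hK hp} = halfLine (p + τ • (-u)) u := by
      ext z
      constructor
      · rintro ⟨hz, hzp⟩
        obtain ⟨s, hs⟩ := hspan _ hzp
        obtain rfl : z = p + s • u := by rw [← hs]; abel
        refine ⟨τ + s, ?_, by module⟩
        by_contra! hneg
        refine hlast (-s) (by linarith) ?_
        simpa using hz
      · rintro ⟨t, ht, rfl⟩
        refine ⟨?_, ?_⟩
        · rcases le_total 0 (t - τ) with h | h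
          · convert hur _ h using 1
            module
          · convert hK.add_smul_mem_of_le hp hmem (s := τ - t) (by linarith) (by linarith) using 1
            module
        · convert Submodule.smul_mem _ (t - τ) hu using 1
          module
    rwa [heq] at hface
  · push Not at hrec
    obtain ⟨u, hu, h₁, h₂⟩ := hrec
    obtain ⟨τ, hτ, hτm⟩ := step hu (by push Not; exact h₁)
    obtain ⟨σ, hσ, hσm⟩ := step (neg_mem hu) (by push Not; exact h₂)
    rcases hτ.eq_or_lt with rfl | hτ
    · simpa using hτm
    have := convex_convexHull ℝ (C.extremePoints ℝ ∪ extremeRayPoints C) hσm hτm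
      (a := τ / (τ + σ)) (b := σ / (τ + σ)) (by positivity) (by positivity) (by field_simp)
    convert this using 1
    match_scalars <;> field_simp
    ring

lemma IsConvexFace.extremePoint_of_halfLine {e v : V} (hv : v ≠ 0) (hK : Convex ℝ C)
    (h : IsConvexFace C (halfLine e v)) : e ∈ C.extremePoints ℝ := by
  have he : e ∈ halfLine e v := ⟨0, le_rfl, by simp⟩
  refine ⟨h.subset he, fun a ha b hb hab => ?_⟩
  by_contra hne
  have hsub := h.openSegment_subset a b (hK.openSegment_subset ha hb) ⟨e, hab, he⟩
  obtain ⟨s, t, hs, ht, hst, heq⟩ := hab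
  obtain rfl : t = 1 - s := by linarith
  -- The step `s * (1 - s)` is below both `s` and `1 - s`, so both symmetric points stay in the open
  -- segment. Both lie on the half-line issuing from their midpoint `e`, so they coincide with `e`.
  obtain ⟨r₁, hr₁, h₁⟩ := hsub (show e + (s * (1 - s)) • (a - b) ∈ openSegment ℝ a b from
    ⟨s + s * (1 - s), 1 - s - s * (1 - s), by positivity, by nlinarith, by ring, by
      rw [← heq]; module⟩)
  obtain ⟨r₂, hr₂, h₂⟩ := hsub (show e - (s * (1 - s)) • (a - b) ∈ openSegment ℝ a b from
    ⟨s - s * (1 - s), 1 - s + s * (1 - s), by nlinarith, by positivity, by ring, by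
      rw [← heq]; module⟩)
  have hsum : (r₁ + r₂) • v = 0 := by
    have h₃ : r₁ • v = (s * (1 - s)) • (a - b) := (add_left_cancel h₁).symm
    have h₄ : r₂ • v = -((s * (1 - s)) • (a - b)) := by
      rw [sub_eq_add_neg] at h₂
      exact (add_left_cancel h₂).symm
    rw [add_smul, h₃, h₄, add_neg_cancel]
  have hr : r₁ + r₂ = 0 := (smul_eq_zero.1 hsum).resolve_right hv
  obtain rfl : r₁ = 0 := by linarith
  rw [zero_smul, add_zero, add_eq_left] at h₁
  have hab : a = b := sub_eq_zero.1 ((smul_eq_zero.1 h₁).resolve_left (by positivity))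
  subst hab
  exact hne (by rw [← heq]; module)

end Hull

/-! ### Carathéodory reduction and the Dubins–Klee theorem -/

section Caratheodory

variable {V : Type*} [AddCommGroup V] [Module ℝ V] {C : Set V} {p : V}

/-- Moving nonnegative coefficients along `c` until the first one vanishes. -/
lemma exists_nonneg_add_mul {ι : Type*} [Fintype ι] {a c : ι → ℝ} (ha : ∀ i, 0 ≤ a i)
    (hc : ∃ i, c i < 0) :
    ∃ τ : ℝ, 0 ≤ τ ∧ (∀ i, 0 ≤ a i + τ * c i) ∧ ∃ i, c i < 0 ∧ a i + τ * c i = 0 := by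
  obtain ⟨i₀, hi₀⟩ := hc
  obtain ⟨i, hi, hmin⟩ := Finset.exists_min_image (Finset.univ.filter fun i => c i < 0)
    (fun i => a i / -c i) ⟨i₀, by simpa⟩
  simp only [Finset.mem_filter, Finset.mem_univ, true_and] at hi hmin
  have hnn : 0 ≤ a i / -c i := div_nonneg (ha i) (by linarith)
  refine ⟨a i / -c i, hnn, fun k => ?_, i, hi, ?_⟩
  · rcases lt_or_ge (c k) 0 with hk | hk
    · have := (le_div_iff₀ (neg_pos.2 hk)).1 (hmin k hk)
      linarith
    · have := ha k
      positivity
  · have := hi.ne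
    field_simp
    ring

/-- Among `d + 1` points and a direction of a `d`-dimensional space there is an affine relation,
which may be taken nonnegative at a given point `i₀`; it is then negative elsewhere. -/
lemma exists_affine_relation {ι : Type*} [Fintype ι] {L : Submodule ℝ V} [FiniteDimensional ℝ L]
    {y : ι → V} {v : V} (hy : ∀ i, y i - p ∈ L) (hv : v ∈ L) (hv0 : v ≠ 0)
    (hcard : Module.finrank ℝ L < Fintype.card ι) (i₀ : ι) :
    ∃ c : Option ι → ℝ, ∑ i, c (some i) = 0 ∧ ∑ i, c (some i) • y i + c none • v = 0 ∧
      0 ≤ c (some i₀) ∧ ∃ o, c o < 0 := by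
  -- Points at height 1 and the direction at height 0: at least `d + 2` vectors in a space of
  -- dimension `d + 1`.
  let g : Option ι → L × ℝ := fun o => o.elim (⟨v, hv⟩, 0) fun i => (⟨y i - p, hy i⟩, 1)
  have hdep : ¬ LinearIndependent ℝ g := fun h => by
    have := h.fintype_card_le_finrank
    rw [Fintype.card_option, Module.finrank_prod, Module.finrank_self] at this
    omega
  rw [Fintype.not_linearIndependent_iff] at hdep
  have key : ∀ c : Option ι → ℝ, ∑ o, c o • g o = 0 → (∃ o, c o ≠ 0) →
      ∑ i, c (some i) = 0 ∧ ∑ i, c (some i) • y i + c none • v = 0 ∧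
        ∃ o, c o < 0 := by
    intro c hc hne
    rw [Fintype.sum_option] at hc
    have h₁ : ∑ i, c (some i) = 0 := by
      simpa [g, Prod.snd_sum] using congrArg Prod.snd hc
    have h₂ : ∑ i, c (some i) • y i + c none • v = 0 := by
      have := congrArg (fun z : L × ℝ => (z.1 : V)) hc
      simp only [g, Option.elim, Prod.fst_add, Prod.smul_mk, Prod.fst_sum, Submodule.coe_add,
        Submodule.coe_smul, Submodule.coe_sum, Prod.fst_zero, Submodule.coe_zero, smul_sub,
        Finset.sum_sub_distrib, ← Finset.sum_smul, h₁, zero_smul, sub_zero] at this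
      rwa [add_comm]
    refine ⟨h₁, h₂, ?_⟩
    by_contra! hnn
    have h₃ : ∀ i, c (some i) = 0 := fun i =>
      (Finset.sum_eq_zero_iff_of_nonneg fun i _ => hnn (some i)).1 h₁ i (Finset.mem_univ i)
    simp only [h₃, zero_smul, Finset.sum_const_zero, zero_add] at h₂
    obtain ⟨_ | i, ho⟩ := hne
    · exact ho ((smul_eq_zero.1 h₂).resolve_right hv0)
    · exact ho (h₃ i)
  obtain ⟨c, hc, hne⟩ := hdep
  rcases le_total 0 (c (some i₀)) with h | h
  · obtain ⟨h₁, h₂, h₃⟩ := key c hc hne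
    exact ⟨c, h₁, h₂, h, h₃⟩
  · obtain ⟨h₁, h₂, h₃⟩ := key (-c) (by simp [hc]) (by simpa using hne)
    have h : 0 ≤ (-c) (some i₀) := by simpa using h
    exact ⟨-c, h₁, h₂, h, h₃⟩

/-- Replacing `z i` by `p` in the combination gives the point `p - w i • (z i - p)` of `C`. -/
lemma sub_mem_dirSpace_of_sum_eq (hK : Convex ℝ C) (hp : p ∈ C) {ι : Type*} [Fintype ι]
    {z : ι → V} {w : ι → ℝ} (hz : ∀ i, z i ∈ C) (hw : ∀ i, 0 < w i) (hw1 : ∑ i, w i = 1)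
    (hsum : ∑ i, w i • z i = p) (i : ι) : z i - p ∈ dirSpace hK hp := by
  classical
  refine ⟨feasDir_sub (hz i), w i, hw i, ?_⟩
  have : p + w i • -(z i - p) = ∑ k, w k • Function.update z i p k := by
    rw [← Finset.add_sum_erase _ _ (Finset.mem_univ i)] at hsum ⊢
    rw [Function.update_self, Finset.sum_congr rfl fun k hk => by
      rw [Function.update_of_ne (Finset.ne_of_mem_erase hk)]]
    nth_rewrite 1 [← hsum]
    module
  rw [this]
  refine hK.sum_mem (fun k _ => (hw k).le) hw1 fun k _ => ?_
  by_cases hk : k = i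
  · subst hk
    simpa
  · simpa [hk] using hz k

open Classical in
/-- The quantity decreased by the exchange steps: the number of points plus the number of those
that are not extreme. -/
noncomputable def exchangeRank (C : Set V) (s : Finset V) : ℕ :=
  s.card + (s.filter (· ∉ C.extremePoints ℝ)).card

open Classical in
lemma exchangeRank_mono {s t : Finset V} (h : s ⊆ t) : exchangeRank C s ≤ exchangeRank C t :=
  add_le_add (Finset.card_le_card h) (Finset.card_le_card (Finset.filter_subset_filter _ h))

open Classical in
lemma exchangeRank_image_le {ι : Type*} (I : Finset ι) (z : ι → V) :
    exchangeRank C (I.image z) ≤ I.card + (I.filter (z · ∉ C.extremePoints ℝ)).card := by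
  rw [exchangeRank, Finset.filter_image]
  exact add_le_add Finset.card_image_le Finset.card_image_le

open Classical in
lemma exchangeRank_image_of_injective {ι : Type*} (I : Finset ι) {z : ι → V}
    (hz : Function.Injective z) :
    exchangeRank C (I.image z) = I.card + (I.filter (z · ∉ C.extremePoints ℝ)).card := by
  rw [exchangeRank, Finset.filter_image, Finset.card_image_of_injective _ hz,
    Finset.card_image_of_injective _ hz]

/-- A point of an extreme ray that is not extreme lies in the interior of the ray. -/
lemma exists_eq_add_smul_of_mem_extremeRayPoints (hK : Convex ℝ C) {x : V}
    (hx : x ∈ extremeRayPoints C) (hx' : x ∉ C.extremePoints ℝ) :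
    ∃ e ∈ C.extremePoints ℝ, ∃ v : V, v ≠ 0 ∧ ∃ t : ℝ, 0 < t ∧ x = e + t • v ∧
      ∀ r : ℝ, 0 ≤ r → e + r • v ∈ extremeRayPoints C := by
  obtain ⟨ρ, hρ, hxρ⟩ := hx
  obtain ⟨⟨e, v, hv, rfl⟩, hface⟩ := hρ
  have he := hface.extremePoint_of_halfLine hv hK
  obtain ⟨t, ht, rfl⟩ := hxρ
  refine ⟨e, he, v, hv, t, ht.lt_of_ne ?_, rfl, fun r hr =>
    ⟨_, ⟨⟨e, v, hv, rfl⟩, hface⟩, r, hr, rfl⟩⟩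
  rintro rfl
  simp [he] at hx'

lemma extremeRayPoints_subset : extremeRayPoints C ⊆ C :=
  fun _ ⟨_, hρ, hx⟩ => hρ.2.subset hx

/-- Split the non-extreme point as `z i₀ = e + t • v` along its ray, so that `p` is a combination of
the points `y` (with `e` in place of `z i₀`) plus `(w i₀ * t) • v`. Move the coefficients along an
affine relation until one vanishes. Either a point disappears, or the coefficient of `v` does and
the ray point becomes the extreme point `e`. -/
lemma exists_exchangeRank_lt (hK : Convex ℝ C) (hp : p ∈ C)
    [FiniteDimensional ℝ (dirSpace hK hp)] {ι : Type*} [Fintype ι] {z : ι → V} {w : ι → ℝ}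
    (hz : ∀ i, z i ∈ C.extremePoints ℝ ∪ extremeRayPoints C) (hinj : Function.Injective z)
    (hw : ∀ i, 0 < w i) (hw1 : ∑ i, w i = 1) (hsum : ∑ i, w i • z i = p)
    (hcard : Module.finrank ℝ (dirSpace hK hp) < Fintype.card ι) {i₀ : ι}
    (hi₀ : z i₀ ∉ C.extremePoints ℝ) {s : Finset V} (hs : Set.range z ⊆ s) :
    ∃ s' : Finset V, (s' : Set V) ⊆ C.extremePoints ℝ ∪ extremeRayPoints C ∧
      p ∈ convexHull ℝ (s' : Set V) ∧ exchangeRank C s' < exchangeRank C s := by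
  classical
  have hzC : ∀ i, z i ∈ C := fun i =>
    (hz i).elim (fun h => h.1) fun h => extremeRayPoints_subset h
  have hzL := sub_mem_dirSpace_of_sum_eq hK hp hzC hw hw1 hsum
  obtain ⟨e, he, v, hv0, t, ht, hzt, hray⟩ := exists_eq_add_smul_of_mem_extremeRayPoints hK
    ((hz i₀).resolve_left hi₀) hi₀
  have heL : e - p ∈ dirSpace hK hp :=
    sub_mem_dirSpace_of_openSegment hK hp (b := e + (2 * t) • v) he.1
      (extremeRayPoints_subset (hray _ (by positivity)))
      (z := z i₀) ⟨1 / 2, 1 / 2, by norm_num, by norm_num, by norm_num, by rw [hzt]; module⟩ (hzL i₀)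
  have hvL : v ∈ dirSpace hK hp := by
    have := sub_mem (hzL i₀) heL
    rw [hzt, sub_sub_sub_cancel_right, add_sub_cancel_left] at this
    exact (Submodule.smul_mem_iff _ ht.ne').1 this
  set y : ι → V := Function.update z i₀ e
  have hy : ∀ i, y i - p ∈ dirSpace hK hp := fun i => by
    by_cases hi : i = i₀
    · subst hi
      simpa [y] using heL
    · simpa [y, hi] using hzL i
  obtain ⟨c, hc₁, hc₂, hc₀, hcneg⟩ := exists_affine_relation hy hvL hv0 hcard i₀
  let a : Option ι → ℝ := fun o => o.elim (w i₀ * t) w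
  have ha : ∀ o, 0 ≤ a o := by
    rintro (_ | i)
    · exact mul_nonneg (hw i₀).le ht.le
    · exact (hw i).le
  obtain ⟨τ, hτ, hnn, o, ho, hzero⟩ := exists_nonneg_add_mul ha hcneg
  set w' : ι → ℝ := fun i => w i + τ * c (some i) with hw'
  set σ : ℝ := w i₀ * t + τ * c none with hσ
  have hσ0 : 0 ≤ σ := hnn none
  have hw'nn : ∀ i, 0 ≤ w' i := fun i => hnn (some i)
  -- The sign chosen for the relation keeps this weight positive, so `e` and the multiple of `v`
  -- recombine into the point `x₀` of the same ray.
  have hw'₀ : 0 < w' i₀ := add_pos_of_pos_of_nonneg (hw i₀) (mul_nonneg hτ hc₀)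
  have hw'1 : ∑ i, w' i = 1 := by
    simp only [hw', Finset.sum_add_distrib, ← Finset.mul_sum, hc₁, hw1, mul_zero, add_zero]
  set x₀ : V := e + (σ / w' i₀) • v with hx₀
  set z' : ι → V := Function.update z i₀ x₀ with hz'
  have hz'A : ∀ i, z' i ∈ C.extremePoints ℝ ∪ extremeRayPoints C := fun i => by
    by_cases hi : i = i₀
    · subst hi
      simp only [hz', Function.update_self]
      exact Or.inr (hray _ (by positivity))
    · simpa [hz', hi] using hz i
  have hsplit : ∀ (u : ι → ℝ) (x : V),
      ∑ i, u i • Function.update z i₀ x i = u i₀ • x + ∑ i ∈ Finset.univ.erase i₀, u i • z i := by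
    intro u x
    rw [← Finset.add_sum_erase _ _ (Finset.mem_univ i₀), Function.update_self]
    congr 1
    exact Finset.sum_congr rfl fun k hk => by
      rw [Function.update_of_ne (Finset.ne_of_mem_erase hk)]
  have hsum' : ∑ i, w' i • z' i = p := by
    have h₁ : ∑ i, w' i • y i + σ • v = ∑ i, w i • y i + (w i₀ * t) • v := by
      simp only [hw', hσ, add_smul, Finset.sum_add_distrib, mul_smul, ← Finset.smul_sum]
      have : τ • ∑ i, c (some i) • y i + τ • c none • v = 0 := by
        rw [← smul_add, hc₂, smul_zero]
      rw [add_add_add_comm, this, add_zero]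
    have h₂ : ∑ i, w i • y i + (w i₀ * t) • v = p := by
      rw [← hsum, hsplit, ← Finset.add_sum_erase _ _ (Finset.mem_univ i₀), hzt]
      module
    rw [hz', hsplit, hx₀, smul_add, smul_smul, mul_div_cancel₀ _ hw'₀.ne']
    rw [← h₂, ← h₁, hsplit]
    abel
  set I : Finset ι := Finset.univ.filter fun i => w' i ≠ 0
  refine ⟨I.image z', ?_, ?_, ?_⟩
  · intro x hx
    obtain ⟨i, -, rfl⟩ := Finset.mem_image.1 (Finset.mem_coe.1 hx)
    exact hz'A i
  · have hI : ∀ i, i ∉ I → w' i = 0 := fun i hi => by simpa [I] using hi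
    have hI1 : ∑ i ∈ I, w' i = 1 := by
      rw [← hw'1]
      exact Finset.sum_subset (Finset.subset_univ I) fun i _ hi => hI i hi
    have hIp : ∑ i ∈ I, w' i • z' i = p := by
      rw [← hsum']
      exact Finset.sum_subset (Finset.subset_univ I) fun i _ hi => by rw [hI i hi, zero_smul]
    rw [← hIp]
    exact (convex_convexHull ℝ _).sum_mem (fun i _ => hw'nn i) hI1 fun i hi =>
      subset_convexHull ℝ _ (Finset.mem_coe.2 (Finset.mem_image_of_mem z' hi))
  · refine (exchangeRank_image_le I z').trans_lt (lt_of_lt_of_le ?_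
      (exchangeRank_mono (s := Finset.univ.image z)
        (by simpa [Finset.subset_iff, Set.subset_def] using hs)))
    rw [exchangeRank_image_of_injective _ hinj]
    have hle : (I.filter (z' · ∉ C.extremePoints ℝ)) ⊆
        Finset.univ.filter (z · ∉ C.extremePoints ℝ) := fun i hi => by
      by_cases h : i = i₀
      · simpa [h] using hi₀
      · simpa [hz', h] using (Finset.mem_filter.1 hi).2
    -- If the coefficient of `v` vanishes, `x₀ = e` and the non-extreme points are fewer; otherwise
    -- a weight vanishes and the points are fewer.
    rcases o with _ | i
    · refine add_lt_add_of_le_of_lt (Finset.card_le_univ I) (Finset.card_lt_card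
        ((Finset.ssubset_iff_of_subset hle).2 ⟨i₀, by simpa, ?_⟩))
      have : σ = 0 := hzero
      simp [hz', hx₀, this, he]
    · refine add_lt_add_of_lt_of_le (Finset.card_lt_card
        ((Finset.ssubset_iff_of_subset (Finset.subset_univ I)).2 ⟨i, Finset.mem_univ i, ?_⟩))
        (Finset.card_le_card hle)
      have : w' i = 0 := hzero
      simp [I, this]

/-- Affinely independent points with positive weights lie in the affine hull of the elementary face,
so there are at most `d + 1`. Only the case of exactly `d + 1` points, not all extreme, calls for an
exchange, and `exchangeRank` makes this terminate. -/
lemma hasAtomicRepr_of_mem_convexHull (hK : Convex ℝ C) (hp : p ∈ C)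
    [FiniteDimensional ℝ (dirSpace hK hp)] {s : Finset V}
    (hs : (s : Set V) ⊆ C.extremePoints ℝ ∪ extremeRayPoints C)
    (hps : p ∈ convexHull ℝ (s : Set V)) :
    HasAtomicRepr C p (Module.finrank ℝ (dirSpace hK hp)) := by
  classical
  induction hn : exchangeRank C s using Nat.strong_induction_on generalizing s with
  | _ n ih =>
  subst hn
  obtain ⟨ι, _, z, w, hzs, hind, hw, hw1, hsum⟩ := eq_pos_convex_span_of_mem_convexHull hps
  have hzA : ∀ i, z i ∈ C.extremePoints ℝ ∪ extremeRayPoints C := fun i => hs (hzs ⟨i, rfl⟩)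
  have hzC : ∀ i, z i ∈ C := fun i =>
    (hzA i).elim (fun h => h.1) fun h => extremeRayPoints_subset h
  have hzL := sub_mem_dirSpace_of_sum_eq hK hp hzC hw hw1 hsum
  have hmem : p ∈ convexHull ℝ ((Finset.univ.image z : Finset V) : Set V) := by
    rw [← hsum]
    exact (convex_convexHull ℝ _).sum_mem (fun i _ => (hw i).le) hw1
      fun i _ => subset_convexHull ℝ _ (by simp)
  have hcard : Fintype.card ι ≤ Module.finrank ℝ (dirSpace hK hp) + 1 := by
    refine hind.card_le_finrank_succ.trans (Nat.succ_le_succ (Submodule.finrank_mono ?_))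
    rw [vectorSpan_def, Submodule.span_le]
    rintro _ ⟨_, ⟨i, rfl⟩, _, ⟨k, rfl⟩, rfl⟩
    simpa using sub_mem (hzL i) (hzL k)
  by_cases hle : Fintype.card ι ≤ Module.finrank ℝ (dirSpace hK hp)
  · refine Or.inr ⟨Finset.univ.image z, ?_, ?_, hmem⟩
    · exact_mod_cast Finset.card_image_le.trans hle
    · simpa [Set.subset_def] using hzA
  by_cases hext : ∀ i, z i ∈ C.extremePoints ℝ
  · refine Or.inl ⟨Finset.univ.image z, ?_, ?_, hmem⟩
    · exact_mod_cast Finset.card_image_le.trans hcard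
    · simpa [Set.subset_def] using hext
  push Not at hext
  obtain ⟨i₀, hi₀⟩ := hext
  obtain ⟨s', hs', hps', hlt⟩ := exists_exchangeRank_lt hK hp hzA hind.injective hw hw1 hsum
    (not_le.1 hle) hi₀ hzs
  exact ih _ hlt hs' hps' rfl

lemma HasAtomicRepr.mono {k l : ℤ} (h : HasAtomicRepr C p k) (hkl : k ≤ l) :
    HasAtomicRepr C p l := by
  rcases h with ⟨s, hs, h⟩ | ⟨s, hs, h⟩
  · exact Or.inl ⟨s, by linarith, h⟩
  · exact Or.inr ⟨s, by linarith, h⟩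

/-- The theorem of Dubins and Klee: a point with a `d`-dimensional elementary face. -/
lemma hasAtomicRepr_finrank_dirSpace (hC : IsLinearlyClosed C) (hN : ContainsNoLine C)
    (hK : Convex ℝ C) (hp : p ∈ C) [hfin : FiniteDimensional ℝ (dirSpace hK hp)] :
    HasAtomicRepr C p (Module.finrank ℝ (dirSpace hK hp)) := by
  have h := mem_convexHull_extremePoints_union_extremeRayPoints hC hN hK hp hfin
  rw [convexHull_eq_union_convexHull_finite_subsets] at h
  simp only [Set.mem_iUnion] at h
  obtain ⟨s, hs, hps⟩ := h
  exact hasAtomicRepr_of_mem_convexHull hK hp hs hps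

end Caratheodory

/-! ### The dimension count -/

section Dimension

variable {V W : Type*} [AddCommGroup V] [Module ℝ V] [AddCommGroup W] [Module ℝ W]

/-- Rank–nullity for `M → W ⧸ N`, whose kernel embeds in `G`. The last clause is the case where this
map is not surjective. -/
lemma finite_and_finrank_le_of_inf_comap_le [FiniteDimensional ℝ W] (Φ : V →ₗ[ℝ] W)
    {M G : Submodule ℝ V} {N : Submodule ℝ W} [FiniteDimensional ℝ G]
    (h : M ⊓ N.comap Φ ≤ G) :
    FiniteDimensional ℝ M ∧
      Module.finrank ℝ M + Module.finrank ℝ N ≤ Module.finrank ℝ G + Module.finrank ℝ W ∧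
      ((∃ w : W, ∀ a ∈ M, ∀ b ∈ N, w ≠ Φ a + b) →
        Module.finrank ℝ M + Module.finrank ℝ N + 1 ≤
          Module.finrank ℝ G + Module.finrank ℝ W) := by
  set T : M →ₗ[ℝ] W ⧸ N := N.mkQ ∘ₗ Φ ∘ₗ M.subtype
  have hT : ∀ x : LinearMap.ker T, (x : M).1 ∈ G := fun x => h ⟨x.1.2, by
    have hx : N.mkQ (Φ x.1) = 0 := LinearMap.mem_ker.1 x.2
    rwa [← LinearMap.mem_ker, N.ker_mkQ] at hx⟩
  let g : LinearMap.ker T →ₗ[ℝ] G := (M.subtype ∘ₗ (LinearMap.ker T).subtype).codRestrict G hT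
  have hg : Function.Injective g := fun x y hxy => by
    have := congrArg Subtype.val hxy
    exact Subtype.ext (Subtype.ext this)
  have hker : FiniteDimensional ℝ (LinearMap.ker T) := Module.Finite.of_injective g hg
  have hkle : Module.finrank ℝ (LinearMap.ker T) ≤ Module.finrank ℝ G :=
    LinearMap.finrank_le_finrank_of_injective hg
  have hM : FiniteDimensional ℝ M := by
    rw [FiniteDimensional, ← Module.rank_lt_aleph0_iff]
    have h1 : Module.rank ℝ (M ⧸ LinearMap.ker T) < Cardinal.aleph0 := by
      have : FiniteDimensional ℝ (M ⧸ LinearMap.ker T) :=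
        Module.Finite.equiv T.quotKerEquivRange.symm
      exact Module.rank_lt_aleph0 ℝ _
    rw [← (LinearMap.ker T).rank_quotient_add_rank]
    exact Cardinal.add_lt_aleph0 h1 (Module.rank_lt_aleph0 ℝ _)
  have hrn := T.finrank_range_add_finrank_ker
  have hq := N.finrank_quotient_add_finrank
  refine ⟨hM, ?_, ?_⟩
  · have := (LinearMap.range T).finrank_le
    omega
  · rintro ⟨w, hw⟩
    have : Module.finrank ℝ (LinearMap.range T) < Module.finrank ℝ (W ⧸ N) := by
      refine Submodule.finrank_lt fun htop => ?_
      obtain ⟨a, ha⟩ := LinearMap.range_eq_top.1 htop (N.mkQ w)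
      refine hw a a.2 (w - Φ a) ?_ (by abel)
      rw [← N.ker_mkQ, LinearMap.mem_ker, map_sub, ← ha]
      simp [T]
    omega

end Dimension

/-! ### Optimality, slopes and obliqueness -/

section Minimization

variable {V W : Type*} [AddCommGroup V] [Module ℝ V] [AddCommGroup W] [Module ℝ W]
  {R : V → EReal} {f : W → EReal} {Φ : V →ₗ[ℝ] W} {p : V}

lemma IsConvexExt.convex_epigraph (hR : IsConvexExt R) : Convex ℝ (epigraph R) := by
  rw [convex_iff_forall_pos]
  rintro ⟨x, r⟩ hx ⟨y, s⟩ hy a b ha hb hab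
  refine (hR.convex x y a b ha hb hab).trans ?_
  have h₁ : (a : EReal) * R x ≤ (a : EReal) * r :=
    mul_le_mul_of_nonneg_left hx (by exact_mod_cast ha.le)
  have h₂ : (b : EReal) * R y ≤ (b : EReal) * s :=
    mul_le_mul_of_nonneg_left hy (by exact_mod_cast hb.le)
  refine (add_le_add h₁ h₂).trans (le_of_eq ?_)
  simp

lemma IsConvexExt.convex_levelSet (hR : IsConvexExt R) {r : ℝ} (hr : R p = r) :
    Convex ℝ (levelSet R p) := by
  intro x hx y hy a b ha hb hab
  have hx' : (x, r) ∈ epigraph R := by simpa [epigraph, levelSet, hr] using hx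
  have hy' : (y, r) ∈ epigraph R := by simpa [epigraph, levelSet, hr] using hy
  have := hR.convex_epigraph hx' hy' ha hb hab
  have hr' : a * r + b * r = r := by rw [← add_mul, hab, one_mul]
  simpa [epigraph, levelSet, hr, hr'] using this

lemma mem_levelSet_self {X : Type*} (R : X → EReal) (p : X) : p ∈ levelSet R p := le_refl (R p)

lemma feasDir_levelSet_iff {r : ℝ} (hr : R p = r) {v : V} :
    FeasDir (levelSet R p) p v ↔ FeasDir (epigraph R) (p, r) (v, 0) := by
  simp [FeasDir, epigraph, levelSet, hr]

/-- A common step length for feasible directions of the two epigraphs. -/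
lemma FeasDir.exists_common (hR : IsConvexExt R) (hf : IsConvexExt f) {r s : ℝ} (hr : R p = r)
    (hs : f (Φ p) = s) {v : V} {ρ σ : ℝ} (h₁ : FeasDir (epigraph R) (p, r) (v, ρ))
    (h₂ : FeasDir (epigraph f) (Φ p, s) (Φ v, σ)) :
    ∃ ε : ℝ, 0 < ε ∧ R (p + ε • v) ≤ ((r + ε * ρ : ℝ) : EReal) ∧
      f (Φ (p + ε • v)) ≤ ((s + ε * σ : ℝ) : EReal) := by
  obtain ⟨ε, hε, h₁⟩ := h₁
  obtain ⟨δ, hδ, h₂⟩ := h₂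
  have hm : 0 < min ε δ := lt_min hε hδ
  have h₃ := hR.convex_epigraph.add_smul_mem_of_le (show (p, r) ∈ epigraph R from hr.le) h₁ hm.le
    (min_le_left _ _)
  have h₄ := hf.convex_epigraph.add_smul_mem_of_le (show (Φ p, s) ∈ epigraph f from hs.le) h₂ hm.le
    (min_le_right _ _)
  refine ⟨min ε δ, hm, h₃, ?_⟩
  rw [map_add, map_smul]
  exact h₄

lemma slope_add_nonneg (hR : IsConvexExt R) (hf : IsConvexExt f) (hp : p ∈ solutionSet R f Φ)
    {r s : ℝ} (hr : R p = r) (hs : f (Φ p) = s) {v : V} {ρ σ : ℝ}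
    (h₁ : FeasDir (epigraph R) (p, r) (v, ρ)) (h₂ : FeasDir (epigraph f) (Φ p, s) (Φ v, σ)) :
    0 ≤ ρ + σ := by
  obtain ⟨ε, hε, h₃, h₄⟩ := FeasDir.exists_common hR hf hr hs h₁ h₂
  have := (hp (p + ε • v)).trans (add_le_add h₃ h₄)
  rw [hr, hs] at this
  have : r + s ≤ (r + ε * ρ) + (s + ε * σ) := by exact_mod_cast this
  have : 0 ≤ ε * (ρ + σ) := by linarith
  exact nonneg_of_mul_nonneg_right this hε

lemma feasDir_solutionSet (hR : IsConvexExt R) (hf : IsConvexExt f) (hp : p ∈ solutionSet R f Φ)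
    {r s : ℝ} (hr : R p = r) (hs : f (Φ p) = s) {v : V} {ρ σ : ℝ}
    (h₁ : FeasDir (epigraph R) (p, r) (v, ρ)) (h₂ : FeasDir (epigraph f) (Φ p, s) (Φ v, σ))
    (hρσ : ρ + σ ≤ 0) : FeasDir (solutionSet R f Φ) p v := by
  obtain ⟨ε, hε, h₃, h₄⟩ := FeasDir.exists_common hR hf hr hs h₁ h₂
  refine ⟨ε, hε, fun w => ((add_le_add h₃ h₄).trans ?_).trans (hp w)⟩
  rw [hr, hs]
  norm_cast
  nlinarith

lemma convex_solutionSet (hR : IsConvexExt R) (hf : IsConvexExt f) (hp : p ∈ solutionSet R f Φ)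
    {r s : ℝ} (hr : R p = r) (hs : f (Φ p) = s) : Convex ℝ (solutionSet R f Φ) := by
  -- The sum is finite at a solution and no term is `⊥`, so both terms are real.
  have key : ∀ u ∈ solutionSet R f Φ, ∃ a b : ℝ, R u = a ∧ f (Φ u) = b ∧ a + b ≤ r + s := by
    intro u hu
    have hle := hu p
    rw [hr, hs] at hle
    have hRu := hR.ne_bot u
    have hfu := hf.ne_bot (Φ u)
    induction hRv : R u with
    | bot => exact absurd hRv hRu
    | top =>
      rw [hRv, EReal.top_add_of_ne_bot hfu] at hle
      exact absurd hle (not_le.2 (EReal.coe_lt_top (r + s)))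
    | coe a =>
      induction hfv : f (Φ u) with
      | bot => exact absurd hfv hfu
      | top =>
        rw [hRv, hfv, EReal.coe_add_top] at hle
        exact absurd hle (not_le.2 (EReal.coe_lt_top (r + s)))
      | coe b =>
        rw [hRv, hfv] at hle
        exact ⟨a, b, rfl, rfl, by exact_mod_cast hle⟩
  intro u hu v hv α β hα hβ hαβ
  obtain ⟨a, b, ha, hb, hab⟩ := key u hu
  obtain ⟨a', b', ha', hb', hab'⟩ := key v hv
  have h₁ : R (α • u + β • v) ≤ ((α * a + β * a' : ℝ) : EReal) :=
    hR.convex_epigraph (show (u, a) ∈ epigraph R from ha.le)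
      (show (v, a') ∈ epigraph R from ha'.le) hα hβ hαβ
  have h₂ : f (Φ (α • u + β • v)) ≤ ((α * b + β * b' : ℝ) : EReal) := by
    rw [map_add, map_smul, map_smul]
    exact hf.convex_epigraph (show (Φ u, b) ∈ epigraph f from hb.le)
      (show (Φ v, b') ∈ epigraph f from hb'.le) hα hβ hαβ
  refine fun w => ((add_le_add h₁ h₂).trans ?_).trans (hp w)
  rw [hr, hs]
  norm_cast
  obtain rfl : β = 1 - α := by linarith
  nlinarith

/-- The projection to `V` of the directions in which `R` is affine near `p`. -/
def affineDirSpace (hR : IsConvexExt R) {r : ℝ} (hr : R p = r) : Submodule ℝ V :=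
  (dirSpace hR.convex_epigraph (show (p, r) ∈ epigraph R from hr.le)).map (LinearMap.fst ℝ V ℝ)

lemma mem_dirSpace_levelSet_iff (hR : IsConvexExt R) {r : ℝ} (hr : R p = r) {v : V} :
    v ∈ dirSpace (hR.convex_levelSet hr) (mem_levelSet_self R p) ↔
      (v, 0) ∈ dirSpace hR.convex_epigraph (show (p, r) ∈ epigraph R from hr.le) :=
  and_congr (feasDir_levelSet_iff hr) ((feasDir_levelSet_iff hr).trans (by simp))

lemma dirSpace_levelSet_le (hR : IsConvexExt R) {r : ℝ} (hr : R p = r) :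
    dirSpace (hR.convex_levelSet hr) (mem_levelSet_self R p) ≤ affineDirSpace hR hr :=
  fun v hv => ⟨(v, 0), (mem_dirSpace_levelSet_iff hR hr).1 hv, rfl⟩

/-- If `R` and `f ∘ Φ` have slopes `ρ` and `σ` along `v`, optimality along `v` and `-v` gives `ρ + σ
= 0`, so small moves both ways stay optimal. -/
lemma affineDirSpace_inf_comap_le (hR : IsConvexExt R) (hf : IsConvexExt f)
    (hp : p ∈ solutionSet R f Φ) {r s : ℝ} (hr : R p = r) (hs : f (Φ p) = s) :
    affineDirSpace hR hr ⊓ (affineDirSpace hf hs).comap Φ ≤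
      dirSpace (convex_solutionSet hR hf hp hr hs) hp := by
  rintro v ⟨⟨⟨v', ρ⟩, hv, rfl⟩, ⟨⟨w, σ⟩, hw, hvw⟩⟩
  obtain ⟨h₁, h₂⟩ := hv
  obtain ⟨h₃, h₄⟩ := hw
  simp only [LinearMap.fst_apply, Prod.neg_mk] at *
  subst hvw
  rw [← map_neg] at h₄
  have := slope_add_nonneg hR hf hp hr hs h₁ h₃
  have := slope_add_nonneg hR hf hp hr hs h₂ h₄
  exact ⟨feasDir_solutionSet hR hf hp hr hs h₁ h₃ (by linarith),
    feasDir_solutionSet hR hf hp hr hs h₂ h₄ (by linarith)⟩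

/-- If `v` were also a level direction, subtracting would make the vertical vector `(0, ρ)`
two-sided at a boundary point of the epigraph. -/
lemma dirSpace_levelSet_lt (hR : IsConvexExt R) {r : ℝ} (hr : R p = r) {v : V} {ρ : ℝ}
    (hv : (v, ρ) ∈ dirSpace hR.convex_epigraph (show (p, r) ∈ epigraph R from hr.le))
    (hρ : ρ ≠ 0) :
    dirSpace (hR.convex_levelSet hr) (mem_levelSet_self R p) < affineDirSpace hR hr := by
  refine lt_of_le_of_ne (dirSpace_levelSet_le hR hr) fun heq => hρ ?_
  have hmem : v ∈ affineDirSpace hR hr := ⟨_, hv, rfl⟩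
  rw [← heq, mem_dirSpace_levelSet_iff hR hr] at hmem
  have h := sub_mem hv hmem
  simp only [Prod.mk_sub_mk, sub_self, sub_zero] at h
  obtain ⟨⟨ε, hε, h₁⟩, ⟨δ, hδ, h₂⟩⟩ := h
  simp only [epigraph, Set.mem_ofPred_eq, Prod.fst_add, Prod.snd_add, Prod.smul_mk, Prod.neg_mk,
    smul_zero, neg_zero, add_zero, hr, EReal.coe_le_coe_iff, smul_eq_mul] at h₁ h₂
  nlinarith [nonneg_of_mul_nonneg_right (show 0 ≤ ε * ρ by linarith) hε,
    nonneg_of_mul_nonneg_right (show 0 ≤ δ * -ρ by linarith) hδ]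

/-- The witness is a strict descent direction of one term. If it were `Φ a + b`, correcting it by
the level direction of that term would give a move that strictly decreases one term without
increasing the other, against optimality. -/
lemma exists_forall_ne_add_of_not_minimal (hR : IsConvexExt R) (hf : IsConvexExt f)
    (hp : p ∈ solutionSet R f Φ) {r s : ℝ} (hr : R p = r)
    (hs : f (Φ p) = s) (h : iInf R < R p ∨ iInf f < f (Φ p)) :
    ∃ w : W, ∀ a ∈ dirSpace (hR.convex_levelSet hr) (mem_levelSet_self R p),
      ∀ b ∈ dirSpace (hf.convex_levelSet hs) (mem_levelSet_self f (Φ p)), w ≠ Φ a + b := by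
  rcases h with h | h
  · obtain ⟨v, hv⟩ := iInf_lt_iff.1 h
    obtain ⟨c, hvc, hc⟩ := EReal.lt_iff_exists_real_btwn.1 hv
    rw [hr, EReal.coe_lt_coe_iff] at hc
    refine ⟨Φ (v - p), fun a ha b hb heq => ?_⟩
    have h₁ : FeasDir (epigraph R) (p, r) ((v - p, c - r) + (-a, 0)) :=
      (feasDir_sub (x := (p, r)) (show (v, c) ∈ epigraph R from hvc.le)).add hR.convex_epigraph
        hr.le ((feasDir_levelSet_iff hr).1 ha.2)
    have h₂ := (feasDir_levelSet_iff hs).1 hb.1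
    obtain rfl : b = Φ (v - p + -a) := by rw [map_add, heq, map_neg]; abel
    have := slope_add_nonneg hR hf hp hr hs h₁ h₂
    linarith
  · obtain ⟨w, hw⟩ := iInf_lt_iff.1 h
    obtain ⟨c, hwc, hc⟩ := EReal.lt_iff_exists_real_btwn.1 hw
    rw [hs, EReal.coe_lt_coe_iff] at hc
    refine ⟨w - Φ p, fun a ha b hb heq => ?_⟩
    have h₁ : FeasDir (epigraph f) (Φ p, s) ((w - Φ p, c - s) + (-b, 0)) :=
      (feasDir_sub (x := (Φ p, s)) (show (w, c) ∈ epigraph f from hwc.le)).add hf.convex_epigraph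
        hs.le ((feasDir_levelSet_iff hs).1 hb.2)
    rw [Prod.mk_add_mk, heq, add_neg_cancel_right] at h₁
    have := slope_add_nonneg hR hf hp hr hs ((feasDir_levelSet_iff hr).1 ha.1) h₁
    linarith

lemma exists_mem_of_codimIn_eq_one {A : Submodule ℝ (V × ℝ)} {B : Submodule ℝ V}
    (hAB : codimIn A (B.prod ⊥) = 1) : ∃ v ∈ A, v ∉ B.prod ⊥ := by
  by_contra! h
  have htop : (B.prod ⊥).submoduleOf A = ⊤ := Submodule.submoduleOf_eq_top.2 h
  have hsub : Subsingleton (A ⧸ (B.prod ⊥).submoduleOf A) :=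
    Submodule.Quotient.subsingleton_iff.2 htop
  rw [codimIn, rank_subsingleton'] at hAB
  exact zero_ne_one hAB

lemma exists_mem_dirSpace_of_isObliqueFace (hR : IsConvexExt R) {r : ℝ} (hr : R p = r)
    (h : IsObliqueFace (epigraph R) (levelSet R p) p (R p).toReal) :
    ∃ v : V, ∃ ρ : ℝ, ρ ≠ 0 ∧
      (v, ρ) ∈ dirSpace hR.convex_epigraph (show (p, r) ∈ epigraph R from hr.le) := by
  have hr' : (R p).toReal = r := by rw [hr, EReal.toReal_coe]
  rw [IsObliqueFace, hr', vectorSpan_elementaryFace hR.convex_epigraph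
    (show (p, r) ∈ epigraph R from hr.le),
    vectorSpan_elementaryFace (hR.convex_levelSet hr) (mem_levelSet_self R p)] at h
  obtain ⟨⟨v, ρ⟩, hv, hv'⟩ := exists_mem_of_codimIn_eq_one h
  refine ⟨v, ρ, ?_, hv⟩
  rintro rfl
  exact hv' ⟨(mem_dirSpace_levelSet_iff hR hr).2 hv, rfl⟩

/-- The reflection `(w, t) ↦ (w, μ - t)` exchanges the epigraph of `f` and the hypograph of
`μ - f`. -/
lemma mem_hypograph_iff {X : Type*} {f : X → EReal} {μ : ℝ} {x : X × ℝ} :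
    x ∈ hypograph (fun w => (μ : EReal) - f w) ↔ (x.1, μ - x.2) ∈ epigraph f := by
  simp only [hypograph, epigraph, Set.mem_ofPred_eq]
  induction f x.1 with
  | bot => simp
  | top => simpa [EReal.sub_top] using EReal.coe_ne_top (μ - x.2)
  | coe a =>
    norm_cast
    constructor <;> intro h <;> linarith

lemma exists_mem_dirSpace_of_isObliqueFace_hypograph (hf : IsConvexExt f) {w : W} {s μ : ℝ}
    (hs : f w = s)
    (h : IsObliqueFace (hypograph fun w => (μ : EReal) - f w) (levelSet f w) w (μ - s)) :
    ∃ v : W, ∃ ρ : ℝ, ρ ≠ 0 ∧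
      (v, ρ) ∈ dirSpace hf.convex_epigraph (show (w, s) ∈ epigraph f from hs.le) := by
  have hconv : Convex ℝ (hypograph fun w => (μ : EReal) - f w) := by
    rintro x hx y hy a b ha hb hab
    rw [mem_hypograph_iff] at hx hy ⊢
    convert hf.convex_epigraph hx hy ha hb hab using 1
    obtain rfl : b = 1 - a := by linarith
    ext <;> simp
    ring
  have hmem : (w, μ - s) ∈ hypograph fun w => (μ : EReal) - f w := by
    rw [mem_hypograph_iff]
    simp [epigraph, hs]
  have hfeas : ∀ {v : W} {t : ℝ}, FeasDir (hypograph fun w => (μ : EReal) - f w) (w, μ - s) (v, t) →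
      FeasDir (epigraph f) (w, s) (v, -t) := by
    rintro v t ⟨ε, hε, h⟩
    refine ⟨ε, hε, ?_⟩
    rw [mem_hypograph_iff] at h
    convert h using 1
    ext <;> simp
    ring
  rw [IsObliqueFace, vectorSpan_elementaryFace hconv hmem,
    vectorSpan_elementaryFace (hf.convex_levelSet hs) (mem_levelSet_self f w)] at h
  obtain ⟨⟨v, t⟩, ⟨hv₁, hv₂⟩, hv'⟩ := exists_mem_of_codimIn_eq_one h
  have hv : (v, -t) ∈ dirSpace hf.convex_epigraph (show (w, s) ∈ epigraph f from hs.le) :=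
    ⟨hfeas hv₁, by simpa using hfeas hv₂⟩
  refine ⟨v, -t, ?_, hv⟩
  intro ht
  obtain rfl : t = 0 := neg_eq_zero.1 ht
  rw [neg_zero] at hv
  exact hv' ⟨(mem_dirSpace_levelSet_iff hf hs).2 hv, rfl⟩

end Minimization

theorem corollary1 {V : Type*} [AddCommGroup V] [Module ℝ V] (m : ℕ)
    (R : V → EReal) (f : (Fin m → ℝ) → EReal) (Φ : V →ₗ[ℝ] (Fin m → ℝ))
    (hR : IsConvexExt R) (hf : IsConvexExt f) (hΦ : Function.Surjective Φ)
    (p : V) (hp : p ∈ solutionSet R f Φ) (hfin : R p + f (Φ p) < ⊤)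
    (hclosed : IsLinearlyClosed (levelSet R p)) (hline : ContainsNoLine (levelSet R p))
    (j : ℕ) (F : Set V) (hF : IsConvexFace (solutionSet R f Φ) F) (hpF : p ∈ F)
    (hj : affDim F = j)
    (l : ℕ) (hl : affDim (elementaryFace (levelSet f (Φ p)) (Φ p)) = l) :
    ((iInf R < R p ∨ iInf f < f (Φ p)) →
      HasAtomicRepr (levelSet R p) p ((m : ℤ) - l + j - 1)) ∧
    (¬ (iInf R < R p ∨ iInf f < f (Φ p)) →
      HasAtomicRepr (levelSet R p) p ((m : ℤ) - l + j)) ∧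
    (DoubleOblique R f Φ p →
      HasAtomicRepr (levelSet R p) p ((m : ℤ) - l + j - 2)) := by
  obtain ⟨hRtop, hftop⟩ : R p ≠ ⊤ ∧ f (Φ p) ≠ ⊤ := by
    constructor <;> intro h <;> rw [h] at hfin
    · rw [EReal.top_add_of_ne_bot (hf.ne_bot _)] at hfin
      exact lt_irrefl _ hfin
    · rw [EReal.add_top_of_ne_bot (hR.ne_bot _)] at hfin
      exact lt_irrefl _ hfin
  obtain ⟨r, hr⟩ : ∃ r : ℝ, R p = r := ⟨_, (EReal.coe_toReal hRtop (hR.ne_bot p)).symm⟩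
  obtain ⟨s, hs⟩ : ∃ s : ℝ, f (Φ p) = s := ⟨_, (EReal.coe_toReal hftop (hf.ne_bot _)).symm⟩
  have hGfin : FiniteDimensional ℝ (vectorSpan ℝ F) := Module.finite_of_rank_eq_nat hj
  have hGj : Module.finrank ℝ (vectorSpan ℝ F) = j := Module.finrank_eq_of_rank_eq hj
  have hK := hR.convex_levelSet hr
  have hpC : p ∈ levelSet R p := mem_levelSet_self R p
  have hl' : Module.finrank ℝ (dirSpace (hf.convex_levelSet hs) (mem_levelSet_self f (Φ p))) = l := by
    rw [← vectorSpan_elementaryFace (hf.convex_levelSet hs) (mem_levelSet_self f (Φ p))]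
    exact Module.finrank_eq_of_rank_eq hl
  have hinf : affineDirSpace hR hr ⊓ (affineDirSpace hf hs).comap Φ ≤ vectorSpan ℝ F :=
    (affineDirSpace_inf_comap_le hR hf hp hr hs).trans
      (hF.dirSpace_le (convex_solutionSet hR hf hp hr hs) hp hpF)
  have hinf' : dirSpace hK hpC ⊓
      (dirSpace (hf.convex_levelSet hs) (mem_levelSet_self f (Φ p))).comap Φ ≤ vectorSpan ℝ F :=
    (inf_le_inf (dirSpace_levelSet_le hR hr)
      (Submodule.comap_mono (dirSpace_levelSet_le hf hs))).trans hinf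
  obtain ⟨hfd, hle, hlt⟩ := finite_and_finrank_le_of_inf_comap_le Φ hinf'
  have hrepr := hasAtomicRepr_finrank_dirSpace hclosed hline hK hpC
  rw [hGj, hl', Module.finrank_fin_fun] at hle hlt
  refine ⟨fun h => hrepr.mono ?_, fun _ => hrepr.mono (by omega), fun h => hrepr.mono ?_⟩
  · have := hlt (exists_forall_ne_add_of_not_minimal hR hf hp hr hs h)
    omega
  · obtain ⟨h₁, h₂⟩ := h
    obtain ⟨v, ρ, hρ, hv⟩ := exists_mem_dirSpace_of_isObliqueFace hR hr h₁
    have hμ : R p + f (Φ p) = ((r + s : ℝ) : EReal) := by rw [hr, hs, EReal.coe_add]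
    -- Left unsimplified, to match `μ - s` with `μ = r + s`.
    have hμs : (R p + f (Φ p) - f (Φ p)).toReal = r + s - s := by
      rw [hμ, hs, ← EReal.coe_sub, EReal.toReal_coe]
    rw [hμs, hμ] at h₂
    obtain ⟨w, σ, hσ, hw⟩ := exists_mem_dirSpace_of_isObliqueFace_hypograph hf hs h₂
    -- The count is applied to the enlarged spaces; each strict inclusion then saves one.
    obtain ⟨hfd', hle', -⟩ := finite_and_finrank_le_of_inf_comap_le Φ hinf
    have := Submodule.finrank_lt_finrank_of_lt (dirSpace_levelSet_lt hR hr hv hρ)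
    have := Submodule.finrank_lt_finrank_of_lt (dirSpace_levelSet_lt hf hs hw hσ)
    rw [hGj, Module.finrank_fin_fun] at hle'
    omega
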